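/- Let $G$ be a matrix Lie group, that is, a topological group which for some $n \in \mathbb{N}$ is isomorphic, as a topological group, to a closed subgroup of $\mathrm{GL}(n,\mathbb{R})$. Let $G$ act continuously and freely on a second-countable locally compact Hausdorff space $X$. Then the action admits slices: for every compact neighbourhood $K \subseteq G$ of the identity and every $x \in X$ there exists a compact subset $S \subseteq X$ such that the map $K \times S \to X$, $(g,y) \mapsto gy$, is injective (i.e. $S$ is a $K$-slice) and $x \in S \cap (KS)^{\circ}$, where $KS = \{gy : g \in K,\ y \in S\}$ and $(KS)^{\circ}$ is its interior in $X$. -/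

import Mathlib

open scoped Topology Pointwise

/-- A topological group is a (closed) matrix Lie group if, for some `n`, it is isomorphic as a
topological group to a closed subgroup of `GL(n, ℝ)`: there is a group homomorphism into
`GL(n, ℝ)` that is a homeomorphism onto a closed subset. -/
def IsMatrixLieGroup (G : Type*) [Group G] [TopologicalSpace G] : Prop :=
  ∃ (n : ℕ) (ρ : G →* Matrix.GeneralLinearGroup (Fin n) ℝ), Topology.IsClosedEmbedding ρ

/-- An action is free if only the identity has a fixed point. -/
def IsFreeAction (G X : Type*) [Group G] [MulAction G X] : Prop :=
  ∀ (g : G) (x : X), g • x = x → g = 1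

/-- A compact identity neighbourhood in a topological group (not necessarily open). -/
def IsCompactIdentityNhd {G : Type*} [Group G] [TopologicalSpace G] (K : Set G) : Prop :=
  IsCompact K ∧ K ∈ 𝓝 (1 : G)

/-- For a compact identity neighbourhood `K`, a `K`-slice is a compact set `S` in `X` such that
the map `K × S → X`, `(g, x) ↦ g • x`, is injective. -/
def IsKSlice {G X : Type*} [Group G] [TopologicalSpace X] [MulAction G X]
    (K : Set G) (S : Set X) : Prop :=
  IsCompact S ∧ Set.InjOn (fun p : G × X => p.1 • p.2) (K ×ˢ S)

/-- The tube interior `S ∩ (K S)°` of a `K`-slice `S`, the interior being taken in `X`. -/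
def tubeInterior {G X : Type*} [Group G] [TopologicalSpace X] [MulAction G X]
    (K : Set G) (S : Set X) : Set X :=
  S ∩ interior (K • S)

/-- The action admits slices: for every compact identity neighbourhood `K` and every point `x`
there is a `K`-slice whose tube interior contains `x`. -/
def AdmitsSlices (G X : Type*) [Group G] [TopologicalSpace G] [TopologicalSpace X]
    [MulAction G X] : Prop :=
  ∀ K : Set G, IsCompactIdentityNhd K →
    ∀ x : X, ∃ S : Set X, IsKSlice K S ∧ x ∈ tubeInterior K S

/-! ### The tangent space at the identity of a linear group -/

section LinearTransversal

open Filter Metric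

variable {G A : Type*} [Group G] [NormedRing A]

/-! Embed `G` in a matrix algebra `A` by `σ` and let `Q` be a projection of `A` onto the tangent
space of the image at `1`. Near `1`, the affine space `1 + ker Q` is transversal to the left action:
two of its points in one local orbit agree (`exists_pos_forall_eq_one`), and every nearby point can
be moved into it (`eventually_exists_projection_eq_zero`). Haar averaging gives a locally
equivariant `f : X → A` with `f x = 1` (`exists_local_equivariant_map`); the slice is the part of `f
⁻¹ (1 + ker Q)` in a small compact neighbourhood of `x`. Exponential map and inverse function
theorem are replaced by first-order estimates and compactness. -/

theorem norm_map_inv_sub_one_le (σ : G →* A) {g : G} (hg : ‖σ g - 1‖ ≤ 1 / 2) :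
    ‖σ g⁻¹ - 1‖ ≤ 2 * ‖σ g - 1‖ := by
  have h1 : σ g⁻¹ * σ g = 1 := by rw [← map_mul, inv_mul_cancel, map_one]
  have h2 : σ g⁻¹ - 1 = -(σ g - 1) - (σ g⁻¹ - 1) * (σ g - 1) := by
    rw [sub_mul, mul_sub, h1]; noncomm_ring
  have h3 : ‖σ g⁻¹ - 1‖ ≤ ‖σ g - 1‖ + ‖σ g⁻¹ - 1‖ * ‖σ g - 1‖ := by
    calc ‖σ g⁻¹ - 1‖ = ‖-(σ g - 1) - (σ g⁻¹ - 1) * (σ g - 1)‖ := by rw [← h2]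
      _ ≤ ‖-(σ g - 1)‖ + ‖(σ g⁻¹ - 1) * (σ g - 1)‖ := norm_sub_le _ _
      _ ≤ _ := by rw [norm_neg]; gcongr; exact norm_mul_le _ _
  nlinarith [norm_nonneg (σ g⁻¹ - 1), norm_nonneg (σ g - 1)]

theorem norm_one_add_pow_sub_le (u : A) (m : ℕ) (h : m * ‖u‖ ≤ 1) :
    ‖(1 + u) ^ m - 1 - m • u‖ ≤ (m * ‖u‖) ^ 2 := by
  induction m with
  | zero => simp
  | succ m ih =>
    push_cast at h ⊢
    have h0 := norm_nonneg u
    have ih := ih (by nlinarith)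
    set e := (1 + u) ^ m - 1 - m • u with he
    have h1 : (1 + u) ^ (m + 1) - 1 - (m + 1) • u = m • (u * u) + e + e * u := by
      rw [pow_succ, he, add_smul, one_smul]
      simp only [sub_mul, mul_add, mul_one, one_mul, smul_mul_assoc]
      abel
    have h2 : ‖m • (u * u)‖ ≤ m * (‖u‖ * ‖u‖) :=
      (norm_nsmul_le ..).trans (by gcongr; exact norm_mul_le _ _)
    rw [h1]
    have h3 : ‖e * u‖ ≤ ‖e‖ * ‖u‖ := norm_mul_le _ _
    have h4 := norm_add₃_le (a := m • (u * u)) (b := e) (c := e * u)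
    have h5 : ‖e‖ * ‖u‖ ≤ (m * ‖u‖) ^ 2 * ‖u‖ := by gcongr
    have h6 : (m * ‖u‖) ^ 2 * ‖u‖ ≤ m * ‖u‖ ^ 2 := by
      have : (m : ℝ) * ‖u‖ ≤ 1 := by nlinarith
      have h7 : 0 ≤ (m : ℝ) * ‖u‖ ^ 2 := by positivity
      nlinarith
    nlinarith

variable [NormedAlgebra ℝ A]

theorem eventually_nhdsGT_zero_lt {c : ℝ} (hc : 0 < c) : ∀ᶠ t : ℝ in 𝓝[>] 0, t < c :=
  mem_nhdsWithin_of_mem_nhds (Iio_mem_nhds hc)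

theorem norm_sub_one_le_of_norm_sub_smul_le {u a : A} {t η : ℝ} (ht : 0 < t)
    (h : ‖u - 1 - t • a‖ ≤ η * t) :
    ‖u - 1‖ ≤ (‖a‖ + η) * t := by
  calc ‖u - 1‖ = ‖t • a + (u - 1 - t • a)‖ := by congr 1; abel
    _ ≤ ‖t • a‖ + ‖u - 1 - t • a‖ := norm_add_le _ _
    _ ≤ t * ‖a‖ + η * t := by rw [norm_smul, Real.norm_of_nonneg ht.le]; gcongr
    _ = _ := by ring

/-- The image of `σ` meets `1 + t • a + o(t)` for all small `t > 0`. -/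
def IsTangentDirection (σ : G →* A) (a : A) : Prop :=
  ∀ η > 0, ∀ᶠ t : ℝ in 𝓝[>] 0, ∃ g, ‖σ g - 1 - t • a‖ ≤ η * t

namespace IsTangentDirection

theorem zero (σ : G →* A) : IsTangentDirection σ 0 := fun η hη => by
  filter_upwards [self_mem_nhdsWithin] with t ht
  exact ⟨1, by simpa using (mul_pos hη ht).le⟩

variable {σ : G →* A} {a b : A}

theorem add (ha : IsTangentDirection σ a) (hb : IsTangentDirection σ b) :
    IsTangentDirection σ (a + b) := fun η hη => by
  have hc : 0 < (‖a‖ + η / 4) * (‖b‖ + η / 4) := by positivity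
  filter_upwards [ha (η / 4) (by positivity), hb (η / 4) (by positivity),
    self_mem_nhdsWithin, eventually_nhdsGT_zero_lt (div_pos (half_pos hη) hc)]
    with t ⟨g, hg⟩ ⟨h, hh⟩ ht htc
  refine ⟨g * h, ?_⟩
  have ht : 0 < t := ht
  have h1 := norm_sub_one_le_of_norm_sub_smul_le ht hg
  have h2 := norm_sub_one_le_of_norm_sub_smul_le ht hh
  have h3 : σ (g * h) - 1 - t • (a + b) =
      (σ g - 1) * (σ h - 1) + (σ g - 1 - t • a) + (σ h - 1 - t • b) := by
    rw [map_mul, smul_add]; noncomm_ring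
  rw [h3]
  rw [lt_div_iff₀ hc] at htc
  calc _ ≤ _ := norm_add₃_le
    _ ≤ ((‖a‖ + η / 4) * t) * ((‖b‖ + η / 4) * t) + η / 4 * t + η / 4 * t := by
      gcongr
      exact (norm_mul_le _ _).trans (by gcongr)
    _ = (t * ((‖a‖ + η / 4) * (‖b‖ + η / 4))) * t + η / 2 * t := by ring
    _ ≤ η / 2 * t + η / 2 * t := by gcongr
    _ = η * t := by ring

theorem neg (ha : IsTangentDirection σ a) : IsTangentDirection σ (-a) := fun η hη => by
  have hc : 0 < ‖a‖ + η / 2 := by positivity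
  filter_upwards [ha (η / 2) (by positivity), self_mem_nhdsWithin,
    eventually_nhdsGT_zero_lt (div_pos one_half_pos hc),
    eventually_nhdsGT_zero_lt (div_pos (half_pos hη) (mul_pos two_pos (pow_pos hc 2)))]
    with t ⟨g, hg⟩ ht ht1 ht2
  refine ⟨g⁻¹, ?_⟩
  have ht : 0 < t := ht
  have h1 := norm_sub_one_le_of_norm_sub_smul_le ht hg
  rw [lt_div_iff₀ hc] at ht1
  rw [lt_div_iff₀ (by positivity)] at ht2
  have h2 := norm_map_inv_sub_one_le σ (g := g) (by linarith)
  have h0 : σ g⁻¹ * σ g = 1 := by rw [← map_mul, inv_mul_cancel, map_one]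
  have h3 : σ g⁻¹ - 1 - t • -a = -((σ g⁻¹ - 1) * (σ g - 1)) - (σ g - 1 - t • a) := by
    rw [sub_mul, mul_sub, h0, smul_neg]; noncomm_ring
  rw [h3]
  calc _ ≤ _ := norm_sub_le _ _
    _ ≤ (2 * ((‖a‖ + η / 2) * t)) * ((‖a‖ + η / 2) * t) + η / 2 * t := by
      rw [norm_neg]
      gcongr
      exact (norm_mul_le _ _).trans (by gcongr; exact h2.trans (by gcongr))
    _ = (t * (2 * (‖a‖ + η / 2) ^ 2)) * t + η / 2 * t := by ring
    _ ≤ η / 2 * t + η / 2 * t := by gcongr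
    _ = η * t := by ring

theorem smul_of_pos (ha : IsTangentDirection σ a) {c : ℝ} (hc : 0 < c) :
    IsTangentDirection σ (c • a) := fun η hη => by
  have hlim : Tendsto (fun t : ℝ => t * c) (𝓝[>] 0) (𝓝[>] 0) := by
    refine tendsto_nhdsWithin_iff.2 ⟨?_, ?_⟩
    · refine Tendsto.mono_left ?_ nhdsWithin_le_nhds
      simpa using (continuous_mul_const c).tendsto 0
    · filter_upwards [self_mem_nhdsWithin] with t ht using mul_pos ht hc
  filter_upwards [hlim.eventually (ha (η / c) (by positivity))] with t ⟨g, hg⟩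
  refine ⟨g, ?_⟩
  rw [smul_smul]
  refine hg.trans (le_of_eq ?_)
  field_simp

theorem smul (ha : IsTangentDirection σ a) (c : ℝ) : IsTangentDirection σ (c • a) := by
  rcases lt_trichotomy c 0 with hc | rfl | hc
  · simpa using (ha.smul_of_pos (neg_pos.2 hc)).neg
  · simpa using zero σ
  · exact ha.smul_of_pos hc

/-- Powers of an element close to `1` trace out a discrete one-parameter subgroup, so a limit of
normalised differences is tangent at every small scale `t`. -/
theorem of_forall_exists
    (h : ∀ δ > 0, ∃ g, σ g ≠ 1 ∧ ‖σ g - 1‖ < δ ∧ ‖σ g - 1 - ‖σ g - 1‖ • a‖ ≤ δ * ‖σ g - 1‖) :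
    IsTangentDirection σ a := fun η hη => by
  filter_upwards [self_mem_nhdsWithin, eventually_nhdsGT_zero_lt one_pos,
    eventually_nhdsGT_zero_lt (half_pos hη)] with t ht ht1 ht2
  have ht : 0 < t := ht
  have hc : 0 < t + ‖a‖ := by positivity
  obtain ⟨g, hg, hgδ, hga⟩ := h (η / 2 * t / (t + ‖a‖)) (by positivity)
  set δ := η / 2 * t / (t + ‖a‖) with hδ
  have hδ' : t * δ + δ * ‖a‖ = η / 2 * t := by rw [hδ]; field_simp
  set u := σ g - 1 with hu
  have hs : 0 < ‖u‖ := norm_pos_iff.2 (sub_ne_zero.2 hg)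
  have hδ0 : 0 < δ := hs.trans hgδ
  -- `g ^ m` travels about distance `t`. The errors are the quadratic term of the power, the
  -- deviation of `u` from direction `a`, and the rounding in `m`.
  set m := ⌊t / ‖u‖⌋₊ with hm
  have hm1 : m * ‖u‖ ≤ t := by
    rw [← le_div_iff₀ hs]; exact Nat.floor_le (by positivity)
  have hm2 : t < m * ‖u‖ + ‖u‖ := by
    have := Nat.lt_floor_add_one (t / ‖u‖)
    rw [div_lt_iff₀ hs] at this
    linarith
  refine ⟨g ^ m, ?_⟩
  have h1 : σ (g ^ m) - 1 - t • a = ((1 + u) ^ m - 1 - m • u) + m • (u - ‖u‖ • a)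
      + (m * ‖u‖ - t) • a := by
    have : 1 + u = σ g := by rw [hu]; abel
    rw [this, map_pow, smul_sub m u, sub_smul, ← Nat.cast_smul_eq_nsmul ℝ m (‖u‖ • a), smul_smul]
    abel
  have h2 := norm_one_add_pow_sub_le u m (hm1.trans ht1.le)
  rw [h1]
  calc _ ≤ _ := norm_add₃_le
    _ ≤ t ^ 2 + t * δ + δ * ‖a‖ := by
      gcongr ?_ + ?_ + ?_
      · exact h2.trans (by gcongr)
      · refine (norm_nsmul_le ..).trans ?_
        calc m * ‖u - ‖u‖ • a‖ ≤ m * (δ * ‖u‖) := by gcongr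
          _ = (m * ‖u‖) * δ := by ring
          _ ≤ t * δ := by gcongr
      · rw [norm_smul]
        gcongr
        rw [Real.norm_eq_abs, abs_le]
        constructor <;> linarith
    _ = t * t + η / 2 * t := by linarith
    _ ≤ η / 2 * t + η / 2 * t := by gcongr
    _ = η * t := by ring

end IsTangentDirection

/-- The tangent space at the identity of the image of `σ`. -/
def tangentDirections (σ : G →* A) : Submodule ℝ A where
  carrier := {a | IsTangentDirection σ a}
  add_mem' := .add
  zero_mem' := .zero σ
  smul_mem' c _ h := h.smul c

/-- Otherwise normalised differences would converge to a unit vector `a` with `Q a = 0`; but `a` is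
tangent, so `Q` fixes it. -/
theorem exists_pos_forall_le_norm_projection [FiniteDimensional ℝ A] (σ : G →* A)
    (Q : A →L[ℝ] tangentDirections σ) (hQ : ∀ x : tangentDirections σ, Q x = x) :
    ∃ c > 0, ∃ δ > 0, ∀ g, ‖σ g - 1‖ < δ → c * ‖σ g - 1‖ ≤ ‖Q (σ g - 1)‖ := by
  by_contra! H
  have hpos (n : ℕ) : (0 : ℝ) < 1 / (n + 1) := Nat.one_div_pos_of_nat
  choose g hg1 hg2 using fun n : ℕ => H (1 / (n + 1)) (hpos n) (1 / (n + 1)) (hpos n)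
  set u : ℕ → A := fun n => σ (g n) - 1 with hu
  have hu0 (n : ℕ) : 0 < ‖u n‖ := by
    have h1 := (norm_nonneg _).trans_lt (hg2 n)
    exact pos_of_mul_pos_right h1 (hpos n).le
  have : ProperSpace A := FiniteDimensional.proper ℝ A
  obtain ⟨a, ha, φ, hφ, hlim⟩ := (isCompact_sphere (0 : A) 1).tendsto_subseq
    (x := fun n => ‖u n‖⁻¹ • u n) (fun n => by
      simp [norm_smul, inv_mul_cancel₀ (hu0 n).ne'])
  have hone : Tendsto (fun n => 1 / ((φ n : ℝ) + 1)) atTop (𝓝 0) :=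
    (tendsto_one_div_add_atTop_nhds_zero_nat (𝕜 := ℝ)).comp hφ.tendsto_atTop
  have hmem : IsTangentDirection σ a := by
    refine IsTangentDirection.of_forall_exists fun δ hδ => ?_
    have h1 := hone.eventually (Iio_mem_nhds hδ)
    have h2 := hlim.eventually (ball_mem_nhds a hδ)
    obtain ⟨n, hn1, hn2⟩ := (h1.and h2).exists
    refine ⟨g (φ n), ?_, (hg1 (φ n)).trans hn1, ?_⟩
    · exact sub_ne_zero.1 (norm_pos_iff.1 (hu0 (φ n)))
    · have h3 := hu0 (φ n)
      have h4 : σ (g (φ n)) - 1 - ‖σ (g (φ n)) - 1‖ • a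
          = ‖u (φ n)‖ • (‖u (φ n)‖⁻¹ • u (φ n) - a) := by
        rw [smul_sub, smul_inv_smul₀ h3.ne']
      rw [h4, norm_smul, norm_norm, mul_comm]
      gcongr
      exact (mem_ball_iff_norm.1 hn2).le
  have hQa : Q a = 0 := by
    have h1 : Tendsto (fun n => Q (‖u (φ n)‖⁻¹ • u (φ n))) atTop (𝓝 (Q a)) :=
      (Q.continuous.tendsto a).comp hlim
    refine tendsto_nhds_unique h1 (squeeze_zero_norm (fun n => ?_) hone)
    rw [map_smul, norm_smul, norm_inv, norm_norm, inv_mul_le_iff₀ (hu0 _), mul_comm]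
    exact (hg2 (φ n)).le
  have h0 : a = 0 := by
    have := hQ ⟨a, hmem⟩
    rw [hQa] at this
    exact (congrArg Subtype.val this).symm
  simp [h0] at ha

end LinearTransversal

/-! ### Transversality of `1 + ker Q` to the orbits near `1` -/

section LinearSlice

open Filter Metric

variable {G A : Type*} [Group G] [NormedRing A] [NormedAlgebra ℝ A]

theorem exists_pos_forall_eq_one [FiniteDimensional ℝ A] (σ : G →* A)
    (Q : A →L[ℝ] tangentDirections σ) (hQ : ∀ x : tangentDirections σ, Q x = x) :
    ∃ ε > 0, ∀ g, ∀ z : A, ‖z - 1‖ ≤ ε → ‖σ g * z - 1‖ ≤ ε → Q (z - 1) = 0 →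
      Q (σ g * z - 1) = 0 → σ g = 1 := by
  obtain ⟨c, hc, δ, hδ, H⟩ := exists_pos_forall_le_norm_projection σ Q hQ
  have hQc : 0 < ‖Q‖ + 1 := by positivity
  obtain ⟨ε, hε, hε1⟩ := exists_between (show 0 < min (1 / 2) (min (δ / 4) (c / (‖Q‖ + 1))) by
    positivity)
  simp only [lt_min_iff] at hε1
  obtain ⟨h1, h2, h3⟩ := hε1
  refine ⟨ε, hε, fun g z hz hgz hQz hQgz => ?_⟩
  rw [lt_div_iff₀ hQc] at h3
  set u := σ g - 1 with hu
  -- Both slice terms die under `Q`, leaving `Q u = -Q (u * (z - 1))`, which is too small for the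
  -- lower bound `c * ‖u‖` unless `u = 0`.
  have e1 : u = ((σ g * z - 1) - (z - 1)) - u * (z - 1) := by rw [hu]; noncomm_ring
  have e2 : ‖u * (z - 1)‖ ≤ ‖u‖ * ε := (norm_mul_le _ _).trans (by gcongr)
  have h4 : ‖u‖ ≤ 4 * ε := by
    have := norm_sub_le ((σ g * z - 1) - (z - 1)) (u * (z - 1))
    rw [← e1] at this
    have := norm_sub_le (σ g * z - 1) (z - 1)
    nlinarith [norm_nonneg u]
  have h5 : Q u = -Q (u * (z - 1)) := by
    conv_lhs => rw [e1]
    rw [map_sub, map_sub, hQz, hQgz]; simp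
  have h6 : c * ‖u‖ ≤ ‖Q‖ * (‖u‖ * ε) := by
    refine (H g (by linarith)).trans ?_
    rw [← hu, h5, norm_neg]
    exact (Q.le_opNorm _).trans (by gcongr)
  have h7 : ‖u‖ = 0 := by
    have := norm_nonneg u
    by_contra hne
    have : 0 < ‖u‖ := lt_of_le_of_ne this (Ne.symm hne)
    nlinarith [norm_nonneg Q]
  exact sub_eq_zero.1 (norm_eq_zero.1 h7)

/-- A descent step: moving by `t` in the tangent direction `-Q (w - 1)` shrinks the projection by
the factor `1 - t`, up to an error of at most `3/4` of the gain. -/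
theorem exists_norm_projection_lt (σ : G →* A)
    (Q : A →L[ℝ] tangentDirections σ) (hQ : ∀ x : tangentDirections σ, Q x = x) {w : A}
    (hw : ‖w - 1‖ * (4 * (‖Q‖ + 1)) ≤ 1) (hne : Q (w - 1) ≠ 0) {ρ : ℝ} (hρ : 0 < ρ) :
    ∃ h, ‖σ h - 1‖ < ρ ∧ ‖Q (σ h * w - 1)‖ < ‖Q (w - 1)‖ := by
  set v := Q (w - 1) with hv
  have hv0 : 0 < ‖v‖ := norm_pos_iff.2 hne
  have hQc : 0 < ‖Q‖ + 1 := by positivity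
  set η := ‖v‖ / (4 * (‖Q‖ + 1)) with hη
  have hη0 : 0 < η := by positivity
  have hη1 : η * (4 * (‖Q‖ + 1)) = ‖v‖ := by rw [hη]; field_simp
  have hη2 : η ≤ ‖v‖ := by nlinarith [norm_nonneg Q]
  have htan : IsTangentDirection σ (-(v : A)) := IsTangentDirection.neg v.2
  obtain ⟨t, ⟨h, hh⟩, ht, ht1, ht2⟩ := ((htan η hη0).and
    (Filter.Eventually.and (p := (· ∈ Set.Ioi (0 : ℝ))) self_mem_nhdsWithin
    ((eventually_nhdsGT_zero_lt one_pos).and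
    (eventually_nhdsGT_zero_lt (c := ρ / (2 * ‖v‖)) (by positivity))))).exists
  have ht : 0 < t := ht
  have h1 := norm_sub_one_le_of_norm_sub_smul_le ht hh
  have hvn : ‖(v : A)‖ = ‖v‖ := rfl
  rw [norm_neg, hvn] at h1
  rw [lt_div_iff₀ (by positivity)] at ht2
  have h2 : ‖σ h - 1‖ ≤ 2 * ‖v‖ * t := h1.trans (by gcongr; linarith)
  refine ⟨h, by nlinarith, ?_⟩
  have e1 : σ h * w - 1 = (w - 1) - t • (v : A)
      + ((σ h - 1 - t • -(v : A)) + (σ h - 1) * (w - 1)) := by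
    rw [smul_neg]; noncomm_ring
  have e2 : Q (σ h * w - 1) = (1 - t) • v
      + Q ((σ h - 1 - t • -(v : A)) + (σ h - 1) * (w - 1)) := by
    rw [e1, map_add, map_sub, map_smul, hQ, ← hv, sub_smul, one_smul]
  have e3 : ‖(σ h - 1) * (w - 1)‖ ≤ 2 * ‖v‖ * t * ‖w - 1‖ :=
    (norm_mul_le _ _).trans (by gcongr)
  have e4 : ‖Q ((σ h - 1 - t • -(v : A)) + (σ h - 1) * (w - 1))‖
      ≤ (‖Q‖ + 1) * (η * t + 2 * ‖v‖ * t * ‖w - 1‖) := by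
    refine (Q.le_opNorm _).trans ?_
    gcongr
    · linarith
    · exact (norm_add_le _ _).trans (by gcongr)
  have e5 : (‖Q‖ + 1) * (η * t + 2 * ‖v‖ * t * ‖w - 1‖) ≤ 3 / 4 * (t * ‖v‖) := by
    have a1 : (‖Q‖ + 1) * (η * t) = t * ‖v‖ / 4 := by rw [← hη1]; ring
    have a2 : (t * ‖v‖) * (‖w - 1‖ * (4 * (‖Q‖ + 1))) ≤ (t * ‖v‖) * 1 := by gcongr
    nlinarith
  have e6 : ‖(1 - t) • v‖ = (1 - t) * ‖v‖ := by
    rw [norm_smul, Real.norm_of_nonneg (by linarith)]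
  rw [e2]
  have e7 := norm_add_le ((1 - t) • v) (Q ((σ h - 1 - t • -(v : A)) + (σ h - 1) * (w - 1)))
  have : 0 < t * ‖v‖ := by positivity
  nlinarith

variable [TopologicalSpace G]

/-- Minimise `‖Q (σ g * z - 1)‖` over a compact ball in `G`. The lower bound on `Q` keeps the
minimiser off the bounding sphere, so a nonzero minimum could be lowered by
`exists_norm_projection_lt`. -/
theorem eventually_exists_projection_eq_zero [FiniteDimensional ℝ A] [LocallyCompactSpace G]
    (σ : G →* A) (hσ : Topology.IsInducing σ)
    (Q : A →L[ℝ] tangentDirections σ) (hQ : ∀ x : tangentDirections σ, Q x = x)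
    {N : Set G} (hN : N ∈ 𝓝 (1 : G)) :
    ∀ᶠ z in 𝓝 (1 : A), ∃ g ∈ N, Q (σ g * z - 1) = 0 := by
  obtain ⟨c, hc, δ, hδ, H⟩ := exists_pos_forall_le_norm_projection σ Q hQ
  obtain ⟨K, hK1, hKN, hK⟩ := local_compact_nhds hN
  obtain ⟨r₀, hr₀, hr₀K⟩ : ∃ r₀ > 0, σ ⁻¹' ball 1 r₀ ⊆ K := by
    rw [hσ.nhds_eq_comap, map_one, (nhds_basis_ball.comap σ).mem_iff] at hK1
    exact hK1
  have hQc : 0 < ‖Q‖ + 1 := by positivity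
  obtain ⟨r, hr, hr1⟩ := exists_between
    (show 0 < min r₀ (min δ (1 / (8 * (‖Q‖ + 1)))) by positivity)
  simp only [lt_min_iff] at hr1
  obtain ⟨hrr₀, hrδ, hrQ⟩ := hr1
  rw [lt_div_iff₀ (by positivity)] at hrQ
  have hBK : σ ⁻¹' closedBall 1 r ⊆ K := fun g hg => hr₀K (closedBall_subset_ball hrr₀ hg)
  have hB : IsCompact (σ ⁻¹' closedBall 1 r) :=
    hK.of_isClosed_subset (isClosed_closedBall.preimage hσ.continuous) hBK
  have ha : 0 < r + ‖(1 : A)‖ := by positivity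
  have hz1 : ∀ᶠ z in 𝓝 (1 : A), ‖z - 1‖ < c * r / (‖Q‖ * (r + ‖(1 : A)‖) + ‖Q‖ + 1) := by
    simp only [← dist_eq_norm]
    exact ball_mem_nhds _ (by positivity)
  have hz2 : ∀ᶠ z in 𝓝 (1 : A), ‖z - 1‖ < r / (r + ‖(1 : A)‖) := by
    simp only [← dist_eq_norm]
    exact ball_mem_nhds _ (by positivity)
  filter_upwards [hz1, hz2] with z hz1 hz2
  rw [lt_div_iff₀ (by positivity)] at hz1
  rw [lt_div_iff₀ ha] at hz2
  obtain ⟨g, hg, hmin⟩ := hB.exists_isMinOn ⟨1, by simp [hr.le]⟩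
    (f := fun g => ‖Q (σ g * z - 1)‖)
    (by have := hσ.continuous; fun_prop)
  refine ⟨g, hKN (hBK hg), ?_⟩
  have hgr : ‖σ g - 1‖ ≤ r := by simpa [dist_eq_norm] using hg
  have hσg : ‖σ g‖ ≤ r + ‖(1 : A)‖ := by
    have := norm_add_le (σ g - 1) 1
    rw [sub_add_cancel] at this
    linarith
  have e0 : σ g * z - 1 = (σ g - 1) + σ g * (z - 1) := by noncomm_ring
  have e1 : ‖σ g * (z - 1)‖ ≤ (r + ‖(1 : A)‖) * ‖z - 1‖ :=
    (norm_mul_le _ _).trans (by gcongr)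
  have hlt : ‖σ g - 1‖ < r := by
    refine lt_of_le_of_ne hgr fun heq => ?_
    have h1 : ‖Q (σ g * z - 1)‖ ≤ ‖Q‖ * ‖z - 1‖ := by
      have := hmin (show (1 : G) ∈ σ ⁻¹' closedBall 1 r by simp [hr.le])
      simp only [Set.mem_ofPred_eq, map_one, one_mul] at this
      exact this.trans (Q.le_opNorm _)
    have h2 := H g (hgr.trans_lt hrδ)
    have h3 : Q (σ g - 1) = Q (σ g * z - 1) - Q (σ g * (z - 1)) := by
      rw [e0, map_add, add_sub_cancel_right]
    have h4 : ‖Q (σ g * (z - 1))‖ ≤ ‖Q‖ * ((r + ‖(1 : A)‖) * ‖z - 1‖) :=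
      (Q.le_opNorm _).trans (by gcongr)
    rw [h3, heq] at h2
    have h5 := norm_sub_le (Q (σ g * z - 1)) (Q (σ g * (z - 1)))
    nlinarith [norm_nonneg (z - 1)]
  by_contra hne
  have hw : ‖σ g * z - 1‖ * (4 * (‖Q‖ + 1)) ≤ 1 := by
    have : ‖σ g * z - 1‖ ≤ 2 * r := by
      rw [e0]
      refine (norm_add_le _ _).trans ?_
      linarith
    calc _ ≤ 2 * r * (4 * (‖Q‖ + 1)) := by gcongr
      _ ≤ 1 := by linarith
  obtain ⟨h, hh1, hh2⟩ := exists_norm_projection_lt σ Q hQ hw hne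
    (ρ := (r - ‖σ g - 1‖) / (r + ‖(1 : A)‖)) (div_pos (by linarith) ha)
  rw [lt_div_iff₀ ha] at hh1
  have hmem : h * g ∈ σ ⁻¹' closedBall 1 r := by
    have e : σ (h * g) - 1 = (σ h - 1) * σ g + (σ g - 1) := by rw [map_mul]; noncomm_ring
    have e' : ‖(σ h - 1) * σ g‖ ≤ ‖σ h - 1‖ * (r + ‖(1 : A)‖) :=
      (norm_mul_le _ _).trans (by gcongr)
    rw [Set.mem_preimage, mem_closedBall, dist_eq_norm, e]
    exact (norm_add_le _ _).trans (by linarith)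
  have := hmin hmem
  simp only [Set.mem_ofPred_eq, map_mul, mul_assoc] at this
  linarith

end LinearSlice

/-! ### Locally equivariant maps by averaging -/

section EquivariantMap

open Filter MeasureTheory

variable {G X : Type*} [Group G] [TopologicalSpace G]
  [TopologicalSpace X] [T2Space X] [MulAction G X] [ContinuousSMul G X]

/-- The compact set `L \ interior V` moves `x` off itself, hence uniformly so near `x`. -/
theorem IsFreeAction.exists_mem_nhds_forall_mem (hfree : IsFreeAction G X) (x : X)
    {L V : Set G} (hL : IsCompact L) (hV : V ∈ 𝓝 (1 : G)) :
    ∃ U ∈ 𝓝 x, ∀ g ∈ L, ∀ y ∈ U, g • y ∈ U → g ∈ V := by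
  have h1 : ∀ᶠ p : X × X in 𝓝 (x, x), ∀ g ∈ L \ interior V, g • p.1 ≠ p.2 := by
    refine (hL.diff isOpen_interior).eventually_forall_of_forall_eventually fun g hg => ?_
    have hne : g • x ≠ x := fun h =>
      hg.2 (hfree g x h ▸ mem_interior_iff_mem_nhds.2 hV)
    have hcont : Continuous fun q : (X × X) × G => (q.2 • q.1.1, q.1.2) := by fun_prop
    exact (isOpen_ne_fun (hcont.fst) (hcont.snd)).mem_nhds hne
  rw [nhds_prod_eq] at h1
  obtain ⟨U, hU, h⟩ := eventually_prod_self_iff'.1 h1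
  refine ⟨U, hU, fun g hg y hy hgy => ?_⟩
  by_contra hgV
  exact h y hy _ hgy g ⟨hg, fun hi => hgV (interior_subset hi)⟩ rfl

theorem exists_local_equivariant_map [IsTopologicalGroup G] [LocallyCompactSpace G]
    [LocallyCompactSpace X]
    {A : Type*} [NormedRing A] [NormedAlgebra ℝ A] [CompleteSpace A]
    (σ : G →* A) (hσ : Continuous σ) (hfree : IsFreeAction G X) (x : X)
    {L : Set G} (hL : IsCompact L) :
    ∃ f : X → A, Continuous f ∧ f x = 1 ∧
      ∃ U ∈ 𝓝 x, ∀ y ∈ U, ∀ h ∈ L, f (h • y) = σ h * f y := by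
  let _ : MeasurableSpace G := borel G
  have _ : BorelSpace G := ⟨rfl⟩
  obtain ⟨V, hV1, hVσ, hV⟩ := local_compact_nhds (x := (1 : G))
    (n := {g | ‖σ g - 1‖ ≤ 1 / 2}) (by
      have h : Continuous fun g => ‖σ g - 1‖ := by fun_prop
      have h1 : ∀ᶠ g in 𝓝 1, ‖σ g - 1‖ < 1 / 2 :=
        h.continuousAt.eventually_lt continuousAt_const (by simp)
      exact h1.mono fun _ => le_of_lt)
  -- With `χ = 1` on both `V` and `L * V`, the cutoff does not spoil the substitution `g ↦ h * g`:
  -- freeness confines the relevant `g` to `V`.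
  obtain ⟨χ, hχ1, -, hχc, hχI⟩ := exists_continuous_one_zero_of_isCompact
    (hV.union (hL.mul hV)) isClosed_empty (Set.disjoint_empty _)
  set T := tsupport χ with hT
  have hTc : IsCompact T := hχc
  obtain ⟨U, hU, hUV⟩ := hfree.exists_mem_nhds_forall_mem x
    (hTc.union (hL.inv.mul hTc)).inv (inv_mem_nhds_one G hV1)
  have hUV' : ∀ g ∈ T ∪ L⁻¹ * T, ∀ y ∈ U, g⁻¹ • y ∈ U → g ∈ V := fun g hg y hy hgy => by
    simpa using hUV g⁻¹ (Set.inv_mem_inv.2 hg) y hy hgy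
  have hxU := mem_of_mem_nhds hU
  obtain ⟨φ, hφ1, hφ0, -, hφI⟩ := exists_continuous_one_zero_of_isCompact
    (isCompact_singleton (x := x)) (isOpen_interior (s := U)).isClosed_compl
    (by simpa [Set.disjoint_singleton_left] using mem_interior_iff_mem_nhds.2 hU)
  have hφx : φ x = 1 := hφ1 rfl
  have hφU : ∀ y, φ y ≠ 0 → y ∈ U := fun y hy => by
    by_contra hyU
    exact hy (hφ0 fun h => hyU (interior_subset h))
  have hχT : ∀ g, χ g ≠ 0 → g ∈ T := fun g hg => subset_tsupport _ hg
  let μ : Measure G := Measure.haar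
  let F : X → A := fun y => ∫ g, (χ g * φ (g⁻¹ • y)) • σ g ∂μ
  have hF : Continuous F := by
    rw [← continuousOn_univ]
    refine continuousOn_integral_of_compact_support hTc ?_ fun y g _ hg => ?_
    · refine Continuous.continuousOn ?_
      simp only [Function.uncurry_def]
      fun_prop
    · have : χ g = 0 := by_contra fun h => hg (hχT g h)
      simp [this]
  have hFequiv : ∀ y ∈ U, ∀ h ∈ L, F (h • y) = σ h * F y := fun y hy h hh => by
    have hcint : Continuous fun g => (χ g * φ (g⁻¹ • y)) • σ g := by fun_prop
    have hcsup : HasCompactSupport fun g => (χ g * φ (g⁻¹ • y)) • σ g :=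
      (hχc.mul_right (f' := fun g => φ (g⁻¹ • y))).smul_right (f' := σ)
    have hint := hcint.integrable_of_hasCompactSupport (μ := μ) hcsup
    calc F (h • y) = ∫ g, (χ (h * g) * φ ((h * g)⁻¹ • h • y)) • σ (h * g) ∂μ :=
          (integral_mul_left_eq_self
            (fun g => (χ g * φ (g⁻¹ • h • y)) • σ g) h).symm
      _ = ∫ g, σ h * ((χ g * φ (g⁻¹ • y)) • σ g) ∂μ := by
          congr 1 with g
          rw [mul_inv_rev, mul_smul g⁻¹ h⁻¹, inv_smul_smul, map_mul σ, mul_smul_comm]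
          congr 1
          by_cases h0 : φ (g⁻¹ • y) = 0
          · simp [h0]
          congr 1
          have hgU := hφU _ h0
          by_cases hg : g ∈ T ∪ L⁻¹ * T
          · have hgV := hUV' g hg y hy hgU
            rw [hχ1 (Or.inl hgV), hχ1 (Or.inr (Set.mul_mem_mul hh hgV))]
            rfl
          · have h1 : χ g = 0 := by_contra fun h => hg (Or.inl (hχT g h))
            have h2 : χ (h * g) = 0 := by_contra fun h' => hg (Or.inr
              ⟨h⁻¹, Set.inv_mem_inv.2 hh, h * g, hχT _ h', by simp⟩)
            rw [h1, h2]
      _ = σ h * F y := integral_const_mul_of_integrable hint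
  -- On `V`, `σ` stays within `1/2` of `1`, so the weighted average at `x` is invertible.
  -- Multiplying by `b` on the right preserves left equivariance.
  have hinv : ∃ b, F x * b = 1 := by
    let w : G → ℝ := fun g => χ g * φ (g⁻¹ • x)
    have hwc : Continuous w := by fun_prop
    have hws : HasCompactSupport w := hχc.mul_right (f' := fun g => φ (g⁻¹ • x))
    have hw0 : 0 ≤ w := fun g => mul_nonneg (hχI g).1 (hφI _).1
    have hwint : Integrable w μ := hwc.integrable_of_hasCompactSupport hws
    have hw1 : w 1 ≠ 0 := by
      have : χ 1 = 1 := hχ1 (Or.inl (mem_of_mem_nhds hV1))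
      simp [w, this, hφx]
    set c := ∫ g, w g ∂μ with hc
    have hcpos : 0 < c := hwc.integral_pos_of_hasCompactSupport_nonneg_nonzero hws hw0 hw1
    have hσint : Integrable (fun g => w g • σ g) μ :=
      (hwc.smul hσ).integrable_of_hasCompactSupport (hws.smul_right (f' := σ))
    have hbound : ‖F x - c • 1‖ ≤ c / 2 := by
      have h1 : F x - c • 1 = ∫ g, w g • (σ g - 1) ∂μ := by
        simp only [smul_sub]
        rw [integral_sub hσint (hwint.smul_const 1), integral_smul_const]
      rw [h1, hc, ← integral_div]
      refine norm_integral_le_of_norm_le (hwint.div_const 2) (Eventually.of_forall fun g => ?_)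
      rw [norm_smul, Real.norm_of_nonneg (hw0 g), div_eq_mul_one_div]
      by_cases hwg : w g = 0
      · simp [hwg]
      have hgV : g ∈ V := hUV' g (Or.inl (hχT g (left_ne_zero_of_mul hwg))) x hxU
        (hφU _ (right_ne_zero_of_mul hwg))
      exact mul_le_mul_of_nonneg_left (hVσ hgV) (hw0 g)
    have hunit : IsUnit (c⁻¹ • F x) := by
      have h1 : ‖c⁻¹ • (c • (1 : A) - F x)‖ < 1 := by
        rw [norm_smul, norm_sub_rev, norm_inv, Real.norm_of_nonneg hcpos.le,
          inv_mul_lt_iff₀ hcpos]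
        linarith
      have h2 := isUnit_one_sub_of_norm_lt_one h1
      rwa [smul_sub, inv_smul_smul₀ hcpos.ne', sub_sub_cancel] at h2
    obtain ⟨b, hb⟩ := hunit.exists_right_inv
    exact ⟨c⁻¹ • b, by rw [mul_smul_comm, ← smul_mul_assoc, hb]⟩
  obtain ⟨b, hb⟩ := hinv
  refine ⟨fun y => F y * b, hF.mul continuous_const, hb, U, hU, fun y hy h hh => ?_⟩
  simp only [hFequiv y hy h hh, mul_assoc]

end EquivariantMap

/-! ### Construction of the slices -/

section Slices

open Filter

theorem admitsSlices_of_isEmbedding {G X A : Type*} [Group G] [TopologicalSpace G]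
    [IsTopologicalGroup G] [LocallyCompactSpace G] [TopologicalSpace X] [T2Space X]
    [LocallyCompactSpace X] [MulAction G X] [ContinuousSMul G X] [NormedRing A]
    [NormedAlgebra ℝ A] [FiniteDimensional ℝ A] (σ : G →* A) (hσ : Topology.IsEmbedding σ)
    (hfree : IsFreeAction G X) : AdmitsSlices G X := by
  intro K ⟨hK, hK1⟩ x
  have : CompleteSpace A := FiniteDimensional.complete ℝ A
  obtain ⟨Q, hQ⟩ := Submodule.ClosedComplemented.of_finiteDimensional (tangentDirections σ)
  obtain ⟨ε, hε, Hinj⟩ := exists_pos_forall_eq_one σ Q hQ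
  -- If `g • y = g' • y'`, then `g'⁻¹ * g` carries `y` to `y'`; equivariance is needed for exactly
  -- such elements.
  have hL : IsCompact (K⁻¹ * K) := hK.inv.mul hK
  have hK1' : (1 : G) ∈ K⁻¹ := by simpa using mem_of_mem_nhds hK1
  obtain ⟨f, hf, hfx, U, hU, hfU⟩ := exists_local_equivariant_map σ hσ.continuous hfree x hL
  obtain ⟨C, hC, hCU, hCc⟩ := local_compact_nhds (x := x) (n := U ∩ {y | ‖f y - 1‖ ≤ ε}) (by
    have h : Continuous fun y => ‖f y - 1‖ := by fun_prop
    have h1 : ∀ᶠ y in 𝓝 x, ‖f y - 1‖ < ε :=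
      h.continuousAt.eventually_lt continuousAt_const (by simpa [hfx] using hε)
    exact inter_mem hU (h1.mono fun _ => le_of_lt))
  have hScl : IsClosed {y | Q (f y - 1) = 0} :=
    isClosed_eq (by fun_prop) continuous_const
  refine ⟨C ∩ {y | Q (f y - 1) = 0}, ⟨hCc.inter_right hScl, ?_⟩,
    ⟨mem_of_mem_nhds hC, by simp [hfx]⟩, ?_⟩
  · rintro ⟨g, y⟩ ⟨hg, hyC, hyQ⟩ ⟨g', y'⟩ ⟨hg', hyC', hyQ'⟩ h
    simp only at h hg hg' hyC hyQ hyC' hyQ'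
    have h1 : (g'⁻¹ * g) • y = y' := by rw [mul_smul, h, inv_smul_smul]
    have h2 := hfU y (hCU hyC).1 _ (Set.mul_mem_mul (Set.inv_mem_inv.2 hg') hg)
    rw [h1] at h2
    have h3 : σ (g'⁻¹ * g) = 1 := by
      refine Hinj _ (f y) (hCU hyC).2 ?_ hyQ ?_
      · rw [← h2]; exact (hCU hyC').2
      · rw [← h2]; exact hyQ'
    have h4 : g'⁻¹ * g = 1 := hσ.injective (h3.trans (map_one σ).symm)
    have h5 : g = g' := (inv_mul_eq_one.1 h4).symm
    subst h5
    simpa using h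
  · rw [mem_interior_iff_mem_nhds]
    have hact : Tendsto (fun p : G × X => p.1 • p.2) (𝓝 1 ×ˢ 𝓝 x) (𝓝 x) := by
      have h : Continuous fun p : G × X => p.1 • p.2 := continuous_smul
      simpa [nhds_prod_eq] using h.tendsto (1, x)
    obtain ⟨N, hN, W, hW, hNW⟩ := mem_prod_iff.1 (hact hC)
    -- `N` keeps `g • z` in `C`, `g ∈ K` makes equivariance available, and `g⁻¹ ∈ K` gives `z = g⁻¹
    -- • (g • z) ∈ K • S`.
    have hsurj := eventually_exists_projection_eq_zero σ hσ.isInducing Q hQ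
      (inter_mem hN (inter_mem hK1 (inv_mem_nhds_one G hK1)))
    rw [← hfx] at hsurj
    filter_upwards [hf.continuousAt.eventually hsurj, hW, hU]
      with z ⟨g, ⟨hgN, hgK, hgK'⟩, hgQ⟩ hzW hzU
    refine ⟨g⁻¹, hgK', g • z, ⟨hNW (Set.mk_mem_prod hgN hzW), ?_⟩, inv_smul_smul g z⟩
    have h1 : g ∈ K⁻¹ * K := ⟨1, hK1', g, hgK, one_mul g⟩
    rw [hfx] at hgQ
    change Q (f (g • z) - 1) = 0
    rw [hfU z hzU g h1, hgQ]

end Slices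

theorem mainTheorem5 {G : Type*} [Group G] [TopologicalSpace G] [IsTopologicalGroup G]
    (hG : IsMatrixLieGroup G)
    {X : Type*} [TopologicalSpace X] [T2Space X] [LocallyCompactSpace X]
    [SecondCountableTopology X] [MulAction G X] [ContinuousSMul G X]
    (hfree : IsFreeAction G X) :
    AdmitsSlices G X := by
  obtain ⟨n, ρ, hρ⟩ := hG
  let _ : NormedRing (Matrix (Fin n) (Fin n) ℝ) := Matrix.linftyOpNormedRing
  let _ : NormedAlgebra ℝ (Matrix (Fin n) (Fin n) ℝ) := Matrix.linftyOpNormedAlgebra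
  have hval : Topology.IsOpenEmbedding
      (Units.val : Matrix.GeneralLinearGroup (Fin n) ℝ → Matrix (Fin n) (Fin n) ℝ) :=
    Units.isOpenEmbedding_val
  have : LocallyCompactSpace (Matrix (Fin n) (Fin n) ℝ) :=
    inferInstanceAs (LocallyCompactSpace (Fin n → Fin n → ℝ))
  have : LocallyCompactSpace (Matrix.GeneralLinearGroup (Fin n) ℝ) := hval.locallyCompactSpace
  -- The only place where closedness of the image is used.
  have : LocallyCompactSpace G := hρ.locallyCompactSpace
  exact admitsSlices_of_isEmbedding
    ((Units.coeHom (Matrix (Fin n) (Fin n) ℝ)).comp ρ)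
    (hval.isEmbedding.comp hρ.isEmbedding) hfree
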